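/- Let $X$ be a countably infinite set, $m:X\to(0,\infty)$, and let $b:X\times X\to[0,\infty)$ satisfy $b(x,x)=0$, $b(x,y)=b(y,x)$ and $\sum_{y}b(x,y)<\infty$ for all $x,y\in X$. Write $x\sim y$ if $b(x,y)>0$. Suppose that the weighted graph $G=(X,b,m)$ is locally finite (every vertex has only finitely many neighbors) and connected, let $d$ be the combinatorial graph distance, let $\mathrm{Deg}(x)=\frac1{m(x)}\sum_y b(x,y)$ and $\mathcal L f(x)=\frac1{m(x)}\sum_y b(x,y)(f(x)-f(y))$. Curvature. For a vertex $x$ and small $\epsilon>0$ let $\mu_x^\epsilon(x)=1-\epsilon\,\mathrm{Deg}(x)$ and $\mu_x^\epsilon(y)=\epsilon\, b(x,y)/m(x)$ for $y\ne x$. Let $W(\mu,\nu)=\inf_\pi\sum_{x,y}\pi(x,y)d(x,y)$, the infimum being over all $\pi:X\times X\to[0,1]$ with marginals $\mu$ and $\nu$. The Ollivier Ricci curvature of $x\neq y$ is $$\kappa(x,y)=\lim_{\epsilon\to0^+}\frac1\epsilon\left(1-\frac{W(\mu_x^\epsilon,\mu_y^\epsilon)}{d(x,y)}\right).$$ For $x_0\in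 X$ let $S_r=\{x\in X: d(x,x_0)=r\}$. The sphere curvature around $x_0$ is given by $\kappa(0)=0$ and $$\kappa(r)=\min_{y\in S_r}\ \max_{x\in S_{r-1},\,x\sim y}\kappa(x,y)\qquad (r\ge1).$$ Stochastic completeness. For a finite set $K\subset X$ let $L_K$ be the operator on functions on $K$ given by $L_Kf=\mathcal L f|_K$, where $f$ is extended by $0$ outside of $K$, let $p^K_t(x,y)=\big(e^{-tL_K}(1_y/m(y))\big)(x)$ for $x,y\in K$, and let $p_t(x,y)=\lim_{K\uparrow X}p_t^K(x,y)$ be the heat kernel of $G$. The graph $G$ is called stochastically complete if $\sum_{y\in X}p_t(x,y)m(y)=1$ for all $x\in X$ and all $t\ge0$. Theorem. If for some vertex $x_0\in X$ and some constant $C>0$ the sphere curvature around $x_0$ satisfies $$\kappa(r)\ge -C\log r$$ for all sufficiently large $r\in\mathbb N$, then $G$ is stochastically complete. -/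

import Mathlib

open Filter Topology

/-- A weighted graph on the vertex set `X`: a vertex measure `m : X → (0, ∞)` and a symmetric edge
weight `b : X × X → [0, ∞)` that vanishes on the diagonal and has finite sum at every vertex. -/
structure WeightedGraph (X : Type*) where
  m : X → ℝ
  m_pos : ∀ x, 0 < m x
  b : X → X → ℝ
  b_nonneg : ∀ x y, 0 ≤ b x y
  b_self : ∀ x, b x x = 0
  b_symm : ∀ x y, b x y = b y x
  b_summable : ∀ x, Summable (b x)

namespace WeightedGraph

variable {X : Type*} (G : WeightedGraph X)

/-! ### The combinatorial graph -/

/-- The underlying combinatorial graph: `x ∼ y` if and only if `b x y > 0`. -/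
def graph : SimpleGraph X where
  Adj x y := 0 < G.b x y
  symm := ⟨fun x y h => G.b_symm x y ▸ h⟩
  loopless := ⟨fun x h => by simp [G.b_self x] at h⟩

/-- Every vertex has only finitely many neighbors. -/
def LocallyFinite : Prop := ∀ x, {y | G.graph.Adj x y}.Finite

/-- Any two vertices are joined by a path. -/
def Connected : Prop := G.graph.Connected

/-- The combinatorial graph distance: the least number of edges in a path from `x` to `y`. -/
noncomputable def dist (x y : X) : ℕ := G.graph.dist x y

/-- The sphere of radius `r` around `x₀`. -/
def sphere (x₀ : X) (r : ℕ) : Set X := {x | G.dist x x₀ = r}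

/-! ### The Laplacian, the heat kernel and stochastic completeness -/

/-- The weighted vertex degree. -/
noncomputable def deg (x : X) : ℝ := (1 / G.m x) * ∑' y, G.b x y

/-- The formal Laplacian `𝓛 f (x) = (1 / m(x)) ∑_y b(x,y) (f(x) - f(y))`. -/
noncomputable def laplacian (f : X → ℝ) (x : X) : ℝ :=
  (1 / G.m x) * ∑' y, G.b x y * (f x - f y)

/-- The restriction of the formal Laplacian to the functions on a finite set `K` (extended by zero
outside of `K`), as a matrix in the basis `1_y`, `y ∈ K`: the entry at `(x, y)` is `𝓛 1_y (x)`. -/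
noncomputable def restrictedLaplacian (K : Finset X) : Matrix K K ℝ :=
  Matrix.of fun x y => G.laplacian (Set.indicator {(y : X)} fun _ => 1) x

open scoped Classical in
/-- The restricted heat kernel `p_t^K(x,y) = (e^{-t L_K} (1_y / m(y))) (x)` for `x, y ∈ K`,
extended by zero to all pairs of vertices. -/
noncomputable def restrictedHeatKernel (K : Finset X) (t : ℝ) (x y : X) : ℝ :=
  if h : x ∈ K ∧ y ∈ K then
    (NormedSpace.exp ((-t) • G.restrictedLaplacian K)) ⟨x, h.1⟩ ⟨y, h.2⟩ / G.m y
  else 0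

/-- `p` is the (minimal) heat kernel of `G`: the limit of the restricted heat kernels as the finite
set `K` increases to `X`. The limit is along the directed set of all finite subsets of `X`, so it
is also the limit along every exhaustion of `X` by an increasing sequence of finite sets. -/
def IsHeatKernel (p : ℝ → X → X → ℝ) : Prop :=
  ∀ t : ℝ, 0 ≤ t → ∀ x y,
    Tendsto (fun K : Finset X => G.restrictedHeatKernel K t x y) atTop (𝓝 (p t x y))

/-- Stochastic completeness: `∑_y p_t(x,y) m(y) = 1` for all vertices `x` and all `t ≥ 0`, where
`p` is the heat kernel. -/
def StochasticallyComplete : Prop :=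
  ∃ p : ℝ → X → X → ℝ, G.IsHeatKernel p ∧
    ∀ x, ∀ t : ℝ, 0 ≤ t → HasSum (fun y => p t x y * G.m y) 1

/-! ### Ollivier Ricci curvature -/

open scoped Classical in
/-- The transition distribution `μ_x^ε`; a probability distribution for `0 ≤ ε ≤ 1 / Deg(x)`. -/
noncomputable def transition (ε : ℝ) (x y : X) : ℝ :=
  if y = x then 1 - ε * G.deg x else ε * G.b x y / G.m x

/-- `π : X × X → [0,1]` has marginals `μ` and `ν`. -/
structure IsTransportPlan (μ ν : X → ℝ) (π : X → X → ℝ) : Prop where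
  nonneg : ∀ x y, 0 ≤ π x y
  le_one : ∀ x y, π x y ≤ 1
  left : ∀ x, HasSum (fun y => π x y) (μ x)
  right : ∀ y, HasSum (fun x => π x y) (ν y)

/-- The Wasserstein distance of `μ` and `ν` with respect to the combinatorial graph distance. -/
noncomputable def wasserstein (μ ν : X → ℝ) : ℝ :=
  sInf {c : ℝ | ∃ π : X → X → ℝ, IsTransportPlan μ ν π ∧
    HasSum (fun q : X × X => π q.1 q.2 * (G.dist q.1 q.2 : ℝ)) c}

/-- `κ^ε(x,y) = 1 - W(μ_x^ε, μ_y^ε) / d(x,y)`, meant for `x ≠ y`. -/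
noncomputable def ollivierCurvatureEps (ε : ℝ) (x y : X) : ℝ :=
  1 - G.wasserstein (G.transition ε x) (G.transition ε y) / (G.dist x y : ℝ)

/-- The Ollivier Ricci curvature `κ(x,y) = lim_{ε → 0+} κ^ε(x,y) / ε`, meant for `x ≠ y`. -/
noncomputable def ollivierCurvature (x y : X) : ℝ :=
  limUnder (𝓝[>] (0 : ℝ)) fun ε => G.ollivierCurvatureEps ε x y / ε

/-- The sphere curvature around `x₀`: `κ(0) = 0` and, for `r ≥ 1`,
`κ(r) = min_{y ∈ S_r} max_{x ∈ S_{r-1}, x ∼ y} κ(x,y)`. In a locally finite connected infinite graph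
the index sets are finite and nonempty, so that `⨅` and `⨆` are a minimum and a maximum. -/
noncomputable def sphereCurvature (x₀ : X) : ℕ → ℝ
  | 0 => 0
  | r + 1 => ⨅ y : G.sphere x₀ (r + 1),
      ⨆ x : {x : X // x ∈ G.sphere x₀ r ∧ G.graph.Adj x y}, G.ollivierCurvature x y

end WeightedGraph

/-! Let `f` be the distance to `x₀`. If `g` is 1-Lipschitz and rises by 1 along an edge from `x` to
`y`, testing transport plans against `g` gives κ(x,y) ≤ 𝓛g(y) − 𝓛g(x) (`ollivierCurvature_le`); only
the easy half of Kantorovich duality is needed. Applying this to `f` and descending to `x₀` sphere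
by sphere, each time through a neighbor of maximal curvature, bounds 𝓛f on the sphere of radius r
below by 𝓛f(x₀) + κ(1) + … + κ(r) (`laplacian_dist_ge`), hence by −A (r+3) log(r+3).

The function w = log log(f+3) has exactly the reciprocal of this growth as its derivative in f. By
concavity, 𝓛w ≥ 𝓛f / ((f+3) log(f+3)) ≥ −A, and w is proper because balls are finite and log log is
unbounded. Khasminskii's criterion (`stochasticallyComplete_of_laplacian_ge`) then applies; it rests
on a comparison principle for the heat equation on finite sets (`Matrix.le_exp_smul_mulVec`). -/

/-! ### Positivity and comparison for matrix exponentials -/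

namespace Matrix

variable {n : Type*} [Fintype n] [DecidableEq n]

open scoped Norms.Operator in
lemma hasSum_exp_apply (A : Matrix n n ℝ) (i j : n) :
    HasSum (fun k : ℕ => ((k.factorial : ℝ)⁻¹ • A ^ k) i j) (NormedSpace.exp A i j) := by
  have h := NormedSpace.exp_series_hasSum_exp' (𝕂 := ℝ) A
  exact Pi.hasSum.1 (Pi.hasSum.1 h i) j

lemma exp_apply_nonneg {A : Matrix n n ℝ} (hA : ∀ i j, 0 ≤ A i j) (i j : n) :
    0 ≤ NormedSpace.exp A i j :=
  (hasSum_exp_apply A i j).nonneg fun k => by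
    simpa using mul_nonneg (by positivity) (pow_apply_nonneg hA k i j)

/-- The exponential of a matrix with nonnegative off-diagonal entries is entrywise nonnegative. -/
lemma exp_apply_nonneg_of_offDiag {A : Matrix n n ℝ} (hA : ∀ i j, i ≠ j → 0 ≤ A i j) (i j : n) :
    0 ≤ NormedSpace.exp A i j := by
  -- Shifting by the scalar matrix `c` makes every entry nonnegative, and scalars commute with `A`.
  set c : ℝ := ∑ l, |A l l| with hc
  have hsplit : A = diagonal (fun _ => -c) + (A + diagonal fun _ => c) := by
    ext a b
    by_cases h : a = b
    · subst h; simp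
    · simp [h]
  have hcomm : Commute (diagonal fun _ : n => -c) (A + diagonal fun _ : n => c) := by
    have : (diagonal fun _ : n => -c) = algebraMap ℝ (Matrix n n ℝ) (-c) := rfl
    rw [this]
    exact Algebra.commutes _ _
  rw [hsplit, exp_add_of_commute _ _ hcomm, exp_diagonal, diagonal_mul]
  refine mul_nonneg ?_ (exp_apply_nonneg (fun a b => ?_) i j)
  · rw [Pi.coe_exp, ← Real.exp_eq_exp_ℝ]; positivity
  · by_cases h : a = b
    · subst h
      have h1 : |A a a| ≤ c :=
        Finset.single_le_sum (f := fun l => |A l l|) (fun l _ => abs_nonneg _) (Finset.mem_univ a)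
      simp only [add_apply, diagonal_apply_eq]
      linarith [neg_abs_le (A a a)]
    · simpa [h] using hA a b h

open scoped Norms.Operator in
lemma hasDerivAt_exp_smul_apply (A : Matrix n n ℝ) (t : ℝ) (i j : n) :
    HasDerivAt (fun s : ℝ => NormedSpace.exp (s • A) i j) ((NormedSpace.exp (t • A) * A) i j) t := by
  have h := hasDerivAt_exp_smul_const (𝕂 := ℝ) A t
  exact hasDerivAt_pi.1 (hasDerivAt_pi.1 h i) j

open scoped Norms.Operator in
lemma hasDerivAt_exp_smul_apply' (A : Matrix n n ℝ) (t : ℝ) (i j : n) :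
    HasDerivAt (fun s : ℝ => NormedSpace.exp (s • A) i j) ((A * NormedSpace.exp (t • A)) i j) t := by
  have h := hasDerivAt_exp_smul_const' (𝕂 := ℝ) A t
  exact hasDerivAt_pi.1 (hasDerivAt_pi.1 h i) j

/-- Comparison principle: a subsolution of `h' = A h` is dominated by the solution with the same
initial value when `A` has nonnegative off-diagonal entries. -/
theorem le_exp_smul_mulVec {A : Matrix n n ℝ} (hA : ∀ i j, i ≠ j → 0 ≤ A i j)
    {h h' : ℝ → n → ℝ} {t : ℝ} (ht : 0 ≤ t)
    (hderiv : ∀ s i, HasDerivAt (fun s => h s i) (h' s i) s)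
    (hsub : ∀ s, 0 ≤ s → s ≤ t → ∀ i, h' s i ≤ (A *ᵥ h s) i) (i : n) :
    h t i ≤ (NormedSpace.exp (t • A) *ᵥ h 0) i := by
  -- Duhamel interpolation: `F 0` is the right-hand side, `F t` the left, and the derivative is
  -- exp((t−s)A) applied to h' − Ah ≤ 0.
  set F : ℝ → ℝ := fun s => ∑ j, NormedSpace.exp ((t - s) • A) i j * h s j with hF
  have hF' : ∀ s, HasDerivAt F
      (∑ j, NormedSpace.exp ((t - s) • A) i j * (h' s j - (A *ᵥ h s) j)) s := by
    intro s
    have h1 : ∀ j, HasDerivAt (fun s => NormedSpace.exp ((t - s) • A) i j * h s j)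
        (-(NormedSpace.exp ((t - s) • A) * A) i j * h s j
          + NormedSpace.exp ((t - s) • A) i j * h' s j) s := by
      intro j
      have h2 := (hasDerivAt_exp_smul_apply A (t - s) i j).comp s
        ((hasDerivAt_const s t).sub (hasDerivAt_id s))
      have h3 := h2.mul (hderiv s j)
      refine h3.congr_deriv ?_
      simp
    have h4 := HasDerivAt.fun_sum fun j (_ : j ∈ Finset.univ) => h1 j
    refine h4.congr_deriv ?_
    have h5 : ∑ j, (NormedSpace.exp ((t - s) • A) * A) i j * h s j
        = ∑ j, NormedSpace.exp ((t - s) • A) i j * (A *ᵥ h s) j := by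
      have := congrFun (mulVec_mulVec (h s) (NormedSpace.exp ((t - s) • A)) A) i
      exact this.symm
    simp only [mul_sub, Finset.sum_sub_distrib, Finset.sum_add_distrib, neg_mul,
      Finset.sum_neg_distrib, h5]
    ring
  have hanti : AntitoneOn F (Set.Icc 0 t) := by
    refine antitoneOn_of_deriv_nonpos (convex_Icc 0 t)
      (fun s _ => (hF' s).continuousAt.continuousWithinAt)
      (fun s _ => (hF' s).differentiableAt.differentiableWithinAt) fun s hs => ?_
    rw [interior_Icc] at hs
    rw [(hF' s).deriv]
    refine Finset.sum_nonpos fun j _ => mul_nonpos_of_nonneg_of_nonpos ?_ ?_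
    · refine exp_apply_nonneg_of_offDiag (fun a b hab => ?_) i j
      simpa using mul_nonneg (sub_nonneg.2 hs.2.le) (hA a b hab)
    · linarith [hsub s hs.1.le hs.2.le j]
  have := hanti (Set.left_mem_Icc.2 ht) (Set.right_mem_Icc.2 ht) ht
  simpa [hF, mulVec, dotProduct, one_apply] using this

end Matrix

/-! ### Restricted heat kernels and their limit -/

namespace WeightedGraph

variable {X : Type*} (G : WeightedGraph X)

open scoped Matrix

lemma tsum_b_mul_indicator_sub (x y : X) :
    ∑' z, G.b x z * (Set.indicator {y} (fun _ => (1 : ℝ)) x - Set.indicator {y} (fun _ => 1) z)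
      = (∑' z, G.b x z) * Set.indicator {y} (fun _ => (1 : ℝ)) x - G.b x y := by
  have h1 := (G.b_summable x).hasSum.mul_right (Set.indicator {y} (fun _ => (1 : ℝ)) x)
  have h2 : HasSum (fun z => G.b x z * Set.indicator {y} (fun _ => (1 : ℝ)) z) (G.b x y) := by
    have := hasSum_single (f := fun z => G.b x z * Set.indicator {y} (fun _ => (1 : ℝ)) z) y
      (fun z hz => by simp [hz])
    simpa using this
  rw [← (h1.sub h2).tsum_eq]
  simp only [mul_sub]

open scoped Classical in
lemma restrictedLaplacian_apply (K : Finset X) (x y : K) :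
    G.restrictedLaplacian K x y = (if x = y then G.deg x else 0) - G.b x y / G.m x := by
  simp only [restrictedLaplacian, Matrix.of_apply, laplacian, tsum_b_mul_indicator_sub, deg]
  by_cases h : x = y
  · subst h; simp; ring
  · have : (x : X) ≠ y := fun h' => h (Subtype.ext h')
    simp [h, this]; ring

lemma neg_restrictedLaplacian_offDiag (K : Finset X) (x y : K) (h : x ≠ y) :
    0 ≤ (-G.restrictedLaplacian K) x y := by
  classical
  rw [Matrix.neg_apply, restrictedLaplacian_apply, if_neg h]
  have := div_nonneg (G.b_nonneg x y) (G.m_pos x).le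
  linarith

lemma neg_restrictedLaplacian_mulVec (K : Finset X) (g : X → ℝ) (x : K) :
    ((-G.restrictedLaplacian K) *ᵥ fun y : K => g y) x
      = (∑ y ∈ K, G.b x y * g y) / G.m x - G.deg x * g x := by
  classical
  simp only [Matrix.mulVec, dotProduct, Matrix.neg_apply, restrictedLaplacian_apply]
  rw [← Finset.sum_coe_sort K (fun y => G.b x y * g y), Finset.sum_div]
  simp only [neg_sub, sub_mul, Finset.sum_sub_distrib, ite_mul, zero_mul, Finset.sum_ite_eq,
    Finset.mem_univ, if_true]
  congr 1
  exact Finset.sum_congr rfl fun y _ => by ring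

lemma restrictedHeatKernel_of_mem {K : Finset X} {t : ℝ} {x y : X} (hx : x ∈ K) (hy : y ∈ K) :
    G.restrictedHeatKernel K t x y * G.m y =
      (open scoped Classical in
        NormedSpace.exp (t • -G.restrictedLaplacian K) ⟨x, hx⟩ ⟨y, hy⟩) := by
  rw [restrictedHeatKernel, dif_pos ⟨hx, hy⟩, div_mul_cancel₀ _ (G.m_pos y).ne', smul_neg, neg_smul]

lemma restrictedHeatKernel_nonneg (K : Finset X) {t : ℝ} (ht : 0 ≤ t) (x y : X) :
    0 ≤ G.restrictedHeatKernel K t x y := by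
  classical
  by_cases h : x ∈ K ∧ y ∈ K
  · refine nonneg_of_mul_nonneg_left ?_ (G.m_pos y)
    rw [G.restrictedHeatKernel_of_mem h.1 h.2]
    exact Matrix.exp_apply_nonneg_of_offDiag (fun a b hab => by
      simpa using mul_nonneg ht (G.neg_restrictedLaplacian_offDiag K a b hab)) _ _
  · rw [restrictedHeatKernel, dif_neg h]

lemma sum_restrictedHeatKernel_mul {K : Finset X} {t : ℝ} {x : X} (hx : x ∈ K) (g : X → ℝ) :
    ∑ y ∈ K, G.restrictedHeatKernel K t x y * G.m y * g y =
      (open scoped Classical in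
        (NormedSpace.exp (t • -G.restrictedLaplacian K) *ᵥ fun y : K => g y) ⟨x, hx⟩) := by
  classical
  rw [← Finset.sum_coe_sort, Matrix.mulVec, dotProduct]
  exact Finset.sum_congr rfl fun y _ => by rw [G.restrictedHeatKernel_of_mem hx y.2]

lemma sum_b_div_le_deg (K : Finset X) (x : X) : (∑ y ∈ K, G.b x y) / G.m x ≤ G.deg x := by
  rw [deg, one_div, inv_mul_eq_div]
  have := (G.b_summable x).sum_le_tsum K fun y _ => G.b_nonneg x y
  have := G.m_pos x
  gcongr

/-- The constant −1 is a subsolution on `K`, since the edge weight from a vertex into `K` is at most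
its full degree. -/
lemma sum_restrictedHeatKernel_le_one (K : Finset X) {t : ℝ} (ht : 0 ≤ t) (x : X) :
    ∑ y ∈ K, G.restrictedHeatKernel K t x y * G.m y ≤ 1 := by
  classical
  by_cases hx : x ∈ K
  · have key := Matrix.le_exp_smul_mulVec (G.neg_restrictedLaplacian_offDiag K)
      (h := fun _ _ => -1) (h' := fun _ _ => 0) ht (fun s _ => hasDerivAt_const s _)
      (fun s _ _ i => by
        rw [G.neg_restrictedLaplacian_mulVec K (fun _ => -1) i]
        simp only [mul_neg, mul_one, Finset.sum_neg_distrib, neg_div]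
        linarith [G.sum_b_div_le_deg K i]) ⟨x, hx⟩
    rw [← G.sum_restrictedHeatKernel_mul hx (fun _ => -1)] at key
    simp only [mul_neg, mul_one, Finset.sum_neg_distrib] at key
    linarith
  · rw [Finset.sum_eq_zero fun y _ => by rw [restrictedHeatKernel, dif_neg (fun h => hx h.1), zero_mul]]
    exact zero_le_one

/-- Extended by zero, the kernel of `K` is a subsolution on the larger set: off `K` it stays zero
while the inflow from its neighbors is nonnegative. -/
lemma restrictedHeatKernel_mono {t : ℝ} (ht : 0 ≤ t) (x y : X) :
    Monotone fun K : Finset X => G.restrictedHeatKernel K t x y := by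
  classical
  intro K K' hK
  by_cases h : x ∈ K ∧ y ∈ K
  swap
  · simp only [restrictedHeatKernel, dif_neg h]
    exact G.restrictedHeatKernel_nonneg K' ht x y
  obtain ⟨hx, hy⟩ := h
  set P : ℝ → X → ℝ := fun s z => G.restrictedHeatKernel K s z y * G.m y with hP
  have hP0 : ∀ s z, z ∉ K → P s z = 0 := fun s z hz => by
    simp only [hP, restrictedHeatKernel, dif_neg (fun h : z ∈ K ∧ y ∈ K => hz h.1), zero_mul]
  have hPK : ∀ s (z : K), P s z
      = NormedSpace.exp (s • -G.restrictedLaplacian K) z ⟨y, hy⟩ :=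
    fun s z => G.restrictedHeatKernel_of_mem z.2 hy
  have hPnn : ∀ s, 0 ≤ s → ∀ z, 0 ≤ P s z := fun s hs z =>
    mul_nonneg (G.restrictedHeatKernel_nonneg K hs z y) (G.m_pos y).le
  set D : ℝ → X → ℝ := fun s z =>
    if z ∈ K then (∑ w ∈ K, G.b z w * P s w) / G.m z - G.deg z * P s z else 0 with hD
  have hderiv : ∀ s z, HasDerivAt (fun s => P s z) (D s z) s := by
    intro s z
    by_cases hz : z ∈ K
    · have h1 := Matrix.hasDerivAt_exp_smul_apply' (-G.restrictedLaplacian K) s ⟨z, hz⟩ ⟨y, hy⟩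
      have h2 : (fun s => P s z) = fun s =>
        NormedSpace.exp (s • -G.restrictedLaplacian K) ⟨z, hz⟩ ⟨y, hy⟩ :=
        funext fun s => hPK s ⟨z, hz⟩
      rw [h2]
      refine h1.congr_deriv ?_
      simp only [hD, if_pos hz]
      rw [← G.neg_restrictedLaplacian_mulVec K (P s) ⟨z, hz⟩, Matrix.mul_apply, Matrix.mulVec,
        dotProduct]
      exact Finset.sum_congr rfl fun w _ => by rw [hPK]
    · have h2 : (fun s => P s z) = fun _ => 0 := funext fun s => hP0 s z hz
      rw [h2]
      simp only [hD, if_neg hz]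
      exact hasDerivAt_const s _
  have key := Matrix.le_exp_smul_mulVec (G.neg_restrictedLaplacian_offDiag K')
    (h := fun s z => P s z) (h' := fun s z => D s z) ht (fun s z => hderiv s z)
    (fun s hs _ z => by
      rw [G.neg_restrictedLaplacian_mulVec K' (P s) z]
      by_cases hz : (z : X) ∈ K
      · simp only [hD, if_pos hz]
        rw [Finset.sum_subset hK fun w _ hw => by rw [hP0 s w hw, mul_zero]]
      · simp only [hD, if_neg hz]
        rw [hP0 s z hz, mul_zero, sub_zero]
        exact div_nonneg (Finset.sum_nonneg fun w _ => mul_nonneg (G.b_nonneg _ _) (hPnn s hs w))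
          (G.m_pos _).le) ⟨x, hK hx⟩
  rw [← G.sum_restrictedHeatKernel_mul (hK hx) (P 0), Finset.sum_eq_single_of_mem y (hK hy)] at key
  · rw [hPK 0 ⟨y, hy⟩] at key
    simp only [zero_smul, NormedSpace.exp_zero, Matrix.one_apply_eq, mul_one] at key
    exact le_of_mul_le_mul_right key (G.m_pos y)
  · intro w _ hw
    by_cases hwK : w ∈ K
    · rw [hPK 0 ⟨w, hwK⟩]
      simp [hw]
    · rw [hP0 0 w hwK, mul_zero]

/-- The heat kernel exists, and its total mass is at most one; it is one as soon as the restricted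
heat kernels carry almost all of the mass. -/
theorem stochasticallyComplete_of_forall_exists
    (h : ∀ x, ∀ t : ℝ, 0 ≤ t → ∀ δ > 0, ∃ K : Finset X,
      1 - δ ≤ ∑ y ∈ K, G.restrictedHeatKernel K t x y * G.m y) :
    G.StochasticallyComplete := by
  classical
  have hbdd : ∀ t : ℝ, 0 ≤ t → ∀ x y,
      BddAbove (Set.range fun K : Finset X => G.restrictedHeatKernel K t x y) := by
    rintro t ht x y
    -- Adjoining `y` to `K` only increases the kernel and makes its value one term of a mass sum
    -- that is at most 1.
    refine ⟨1 / G.m y, ?_⟩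
    rintro _ ⟨K, rfl⟩
    refine (G.restrictedHeatKernel_mono ht x y (Finset.subset_insert y K)).trans ?_
    rw [le_div_iff₀ (G.m_pos y)]
    refine le_trans ?_ (G.sum_restrictedHeatKernel_le_one (insert y K) ht x)
    exact Finset.single_le_sum
      (f := fun z => G.restrictedHeatKernel (insert y K) t x z * G.m z)
      (fun z _ => mul_nonneg (G.restrictedHeatKernel_nonneg _ ht x z) (G.m_pos z).le)
      (Finset.mem_insert_self y K)
  have hlim : G.IsHeatKernel fun t x y => ⨆ K : Finset X, G.restrictedHeatKernel K t x y :=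
    fun t ht x y => tendsto_atTop_ciSup (G.restrictedHeatKernel_mono ht x y) (hbdd t ht x y)
  refine ⟨_, hlim, fun x t ht => ?_⟩
  have hle : ∀ K y, G.restrictedHeatKernel K t x y ≤ ⨆ K : Finset X, G.restrictedHeatKernel K t x y :=
    fun K y => le_ciSup (hbdd t ht x y) K
  refine hasSum_of_isLUB_of_nonneg _ (fun y => mul_nonneg
    ((G.restrictedHeatKernel_nonneg ∅ ht x y).trans (hle ∅ y)) (G.m_pos y).le) ⟨?_, ?_⟩
  · rintro _ ⟨S, rfl⟩
    refine le_of_tendsto (tendsto_finsetSum S fun y _ => (hlim t ht x y).mul_const (G.m y)) ?_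
    filter_upwards [eventually_ge_atTop S] with K hK
    exact (Finset.sum_le_sum_of_subset_of_nonneg hK fun y _ _ =>
      mul_nonneg (G.restrictedHeatKernel_nonneg _ ht x y) (G.m_pos y).le).trans
      (G.sum_restrictedHeatKernel_le_one K ht x)
  · intro c hc
    refine le_of_forall_pos_le_add fun δ hδ => ?_
    obtain ⟨K, hK⟩ := h x t ht δ hδ
    have h1 : ∑ y ∈ K, (⨆ K : Finset X, G.restrictedHeatKernel K t x y) * G.m y ≤ c := hc ⟨K, rfl⟩
    have h2 := Finset.sum_le_sum fun y (_ : y ∈ K) =>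
      mul_le_mul_of_nonneg_right (hle K y) (G.m_pos y).le
    linarith

/-! ### Khasminskii's criterion -/

lemma b_eq_zero_of_not_adj {x y : X} (h : ¬ G.graph.Adj x y) : G.b x y = 0 :=
  le_antisymm (not_lt.1 h) (G.b_nonneg x y)

lemma laplacian_eq_of_subset {x : X} {T : Finset X} (hT : ∀ y, G.graph.Adj x y → y ∈ T)
    (f : X → ℝ) :
    G.laplacian f x = G.deg x * f x - (∑ y ∈ T, G.b x y * f y) / G.m x := by
  have hb : ∀ y ∉ T, G.b x y = 0 := fun y hy => G.b_eq_zero_of_not_adj fun h => hy (hT y h)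
  rw [laplacian, deg, tsum_eq_sum (s := T) fun y hy => by rw [hb y hy, zero_mul],
    tsum_eq_sum (s := T) fun y hy => hb y hy]
  simp only [mul_sub, Finset.sum_sub_distrib, ← Finset.sum_mul]
  ring

/-- Khasminskii's criterion: a nonnegative proper function whose Laplacian is bounded above forces
stochastic completeness. -/
theorem stochasticallyComplete_of_laplacian_ge (hfin : G.LocallyFinite) {w : X → ℝ} {A : ℝ}
    (hw0 : ∀ x, 0 ≤ w x) (hA : 0 ≤ A) (hw : ∀ x, -A ≤ G.laplacian w x)
    (hproper : ∀ M, {x | w x < M}.Finite) : G.StochasticallyComplete := by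
  classical
  refine G.stochasticallyComplete_of_forall_exists fun x t ht δ hδ => ?_
  -- Large enough that `x` lies in {w < M} and (w x + A t)/M ≤ δ.
  set M : ℝ := (w x + A * t) / δ + w x + 1 with hM
  have hnum : 0 ≤ w x + A * t := add_nonneg (hw0 x) (mul_nonneg hA ht)
  have hMx : w x < M := by
    have := div_nonneg hnum hδ.le
    linarith
  have hM0 : 0 < M := (hw0 x).trans_lt hMx
  refine ⟨(hproper M).toFinset, ?_⟩
  set K := (hproper M).toFinset with hK
  have hxK : x ∈ K := by simpa [hK] using hMx
  -- A subsolution that is at most 1 initially, nonpositive off `K` for nonnegative times, and at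
  -- least 1 − δ at `(t, x)`.
  set v : ℝ → X → ℝ := fun s z => 1 - (w z + A * s) / M with hv
  have hderiv : ∀ s z, HasDerivAt (fun s => v s z) (-(A / M)) s := by
    intro s z
    have := ((((hasDerivAt_id s).const_mul A).const_add (w z)).div_const M).const_sub 1
    simpa [hv] using this
  have key := Matrix.le_exp_smul_mulVec (G.neg_restrictedLaplacian_offDiag K)
    (h := fun s z => v s z) (h' := fun _ _ => -(A / M)) ht (fun s z => hderiv s z)
    (fun s hs _ z => by
      rw [G.neg_restrictedLaplacian_mulVec K (v s) z]
      set N := (hfin z).toFinset ∪ K with hN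
      have hTN : ∀ y, G.graph.Adj z y → y ∈ N := fun y hy =>
        Finset.mem_union_left _ ((hfin z).mem_toFinset.2 hy)
      -- Since `v` is nonpositive off `K`, discarding those neighbors only increases the sum, so the
      -- Dirichlet condition preserves the subsolution inequality.
      have h1 : ∑ y ∈ N, G.b z y * v s y ≤ ∑ y ∈ K, G.b z y * v s y := by
        rw [← Finset.sum_sdiff (Finset.subset_union_right : K ⊆ N)]
        refine add_le_of_nonpos_left (Finset.sum_nonpos fun y hy => ?_)
        replace hy := (Finset.mem_sdiff.1 hy).2
        refine mul_nonpos_of_nonneg_of_nonpos (G.b_nonneg _ _) ?_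
        have hy' : M ≤ w y := by simpa [hK] using hy
        have : 1 ≤ (w y + A * s) / M := by
          rw [le_div_iff₀ hM0]
          linarith [mul_nonneg hA hs]
        simp only [hv]; linarith
      have h2 : G.laplacian (v s) z = -(G.laplacian w z / M) := by
        have : ∀ y, G.b z y * (v s z - v s y) = G.b z y * (w z - w y) * (-1 / M) := fun y => by
          simp only [hv]; ring
        simp only [laplacian, this, tsum_mul_right]
        ring
      have h3 := G.laplacian_eq_of_subset hTN (v s)
      have h4 := div_le_div_of_nonneg_right h1 (G.m_pos z).le
      have h5 := div_le_div_of_nonneg_right (hw z) hM0.le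
      rw [neg_div] at h5
      linarith) ⟨x, hxK⟩
  rw [← G.sum_restrictedHeatKernel_mul hxK (v 0)] at key
  have h1 : 1 - δ ≤ v t x := by
    have : (w x + A * t) / M ≤ δ := by
      rw [div_le_iff₀ hM0, ← div_le_iff₀' hδ]
      linarith [hw0 x]
    simp only [hv]; linarith
  refine h1.trans (key.trans (Finset.sum_le_sum fun y _ => ?_))
  refine mul_le_of_le_one_right
    (mul_nonneg (G.restrictedHeatKernel_nonneg _ ht x y) (G.m_pos y).le) ?_
  have := div_nonneg (hw0 y) hM0.le
  simpa [hv] using this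

end WeightedGraph

namespace WeightedGraph

variable {X : Type*} {G : WeightedGraph X}

/-! ### Transport plans -/

namespace IsTransportPlan

variable {μ ν : X → ℝ} {π : X → X → ℝ} {S T : Finset X}

lemma eq_zero_of_left (h : IsTransportPlan μ ν π) {x : X} (hx : μ x = 0) (y : X) : π x y = 0 :=
  le_antisymm (hx ▸ le_hasSum (h.left x) y fun z _ => h.nonneg x z) (h.nonneg x y)

lemma eq_zero_of_right (h : IsTransportPlan μ ν π) {y : X} (hy : ν y = 0) (x : X) : π x y = 0 :=
  le_antisymm (hy ▸ le_hasSum (h.right y) x fun z _ => h.nonneg z y) (h.nonneg x y)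

lemma sum_left (h : IsTransportPlan μ ν π) (hT : ∀ y ∉ T, ν y = 0) (x : X) :
    ∑ y ∈ T, π x y = μ x :=
  (hasSum_sum_of_ne_finset_zero fun y hy => h.eq_zero_of_right (hT y hy) x).unique (h.left x)

lemma sum_right (h : IsTransportPlan μ ν π) (hS : ∀ x ∉ S, μ x = 0) (y : X) :
    ∑ x ∈ S, π x y = ν y :=
  (hasSum_sum_of_ne_finset_zero fun x hx => h.eq_zero_of_left (hS x hx) y).unique (h.right y)

lemma hasSum_cost (h : IsTransportPlan μ ν π) (hS : ∀ x ∉ S, μ x = 0) (hT : ∀ y ∉ T, ν y = 0)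
    (c : X → X → ℝ) :
    HasSum (fun q : X × X => π q.1 q.2 * c q.1 q.2) (∑ x ∈ S, ∑ y ∈ T, π x y * c x y) := by
  rw [← Finset.sum_product']
  refine hasSum_sum_of_ne_finset_zero (s := S ×ˢ T) fun q hq => ?_
  rw [Finset.mem_product, not_and_or] at hq
  rcases hq with hq | hq
  · rw [h.eq_zero_of_left (hS _ hq), zero_mul]
  · rw [h.eq_zero_of_right (hT _ hq), zero_mul]

/-- The easy half of Kantorovich duality. -/
lemma sub_le_cost (h : IsTransportPlan μ ν π) (hS : ∀ x ∉ S, μ x = 0) (hT : ∀ y ∉ T, ν y = 0)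
    {c : X → X → ℝ} {f : X → ℝ} (hf : ∀ x y, f y - f x ≤ c x y) :
    ∑ y ∈ T, ν y * f y - ∑ x ∈ S, μ x * f x ≤ ∑ x ∈ S, ∑ y ∈ T, π x y * c x y := by
  have h1 : ∑ y ∈ T, ν y * f y = ∑ x ∈ S, ∑ y ∈ T, π x y * f y := by
    rw [Finset.sum_comm]
    exact Finset.sum_congr rfl fun y _ => by rw [← Finset.sum_mul, h.sum_right hS]
  have h2 : ∑ x ∈ S, μ x * f x = ∑ x ∈ S, ∑ y ∈ T, π x y * f x :=
    Finset.sum_congr rfl fun x _ => by rw [← Finset.sum_mul, h.sum_left hT]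
  rw [h1, h2, ← Finset.sum_sub_distrib]
  refine Finset.sum_le_sum fun x _ => ?_
  rw [← Finset.sum_sub_distrib]
  refine Finset.sum_le_sum fun y _ => ?_
  rw [← mul_sub]
  exact mul_le_mul_of_nonneg_left (hf x y) (h.nonneg x y)

lemma prod (hμ : ∀ x, 0 ≤ μ x) (hν : ∀ y, 0 ≤ ν y) (hμ1 : HasSum μ 1) (hν1 : HasSum ν 1) :
    IsTransportPlan μ ν fun x y => μ x * ν y where
  nonneg x y := mul_nonneg (hμ x) (hν y)
  le_one x y := mul_le_one₀ (le_hasSum hμ1 x fun z _ => hμ z) (hν y)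
    (le_hasSum hν1 y fun z _ => hν z)
  left x := by simpa using hν1.mul_left (μ x)
  right y := by simpa using hμ1.mul_right (ν y)

lemma convexComb {μ' ν' : X → ℝ} {π' : X → X → ℝ} (h : IsTransportPlan μ ν π)
    (h' : IsTransportPlan μ' ν' π') {s t : ℝ} (hs : 0 ≤ s) (ht : 0 ≤ t) (hst : s + t = 1) :
    IsTransportPlan (fun x => s * μ x + t * μ' x) (fun y => s * ν y + t * ν' y)
      fun x y => s * π x y + t * π' x y where
  nonneg x y := add_nonneg (mul_nonneg hs (h.nonneg x y)) (mul_nonneg ht (h'.nonneg x y))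
  le_one x y := by
    have h1 := mul_le_mul_of_nonneg_left (h.le_one x y) hs
    have h2 := mul_le_mul_of_nonneg_left (h'.le_one x y) ht
    linarith
  left x := ((h.left x).mul_left s).add ((h'.left x).mul_left t)
  right y := ((h.right y).mul_left s).add ((h'.right y).mul_left t)

end IsTransportPlan

/-! ### Transition distributions -/

open scoped Classical in
/-- The closed ball of radius one around `x`. -/
noncomputable def closedNeighborFinset (hfin : G.LocallyFinite) (x : X) : Finset X :=
  insert x (hfin x).toFinset

lemma mem_closedNeighborFinset_self (hfin : G.LocallyFinite) (x : X) :
    x ∈ closedNeighborFinset hfin x := by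
  simp [closedNeighborFinset]

lemma mem_closedNeighborFinset_of_adj (hfin : G.LocallyFinite) {x y : X} (h : G.graph.Adj x y) :
    y ∈ closedNeighborFinset hfin x := by
  simp [closedNeighborFinset, h]

lemma transition_eq_zero (hfin : G.LocallyFinite) (ε : ℝ) {x y : X}
    (hy : y ∉ closedNeighborFinset hfin x) : G.transition ε x y = 0 := by
  have h1 : y ≠ x := fun h => hy (h ▸ mem_closedNeighborFinset_self hfin x)
  rw [transition, if_neg h1, G.b_eq_zero_of_not_adj
    fun h => hy (mem_closedNeighborFinset_of_adj hfin h), mul_zero, zero_div]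

/-- This exact expansion in ε is how the Laplacian enters the transport problem. -/
lemma sum_transition_mul (hfin : G.LocallyFinite) (ε : ℝ) (x : X) (f : X → ℝ) :
    ∑ y ∈ closedNeighborFinset hfin x, G.transition ε x y * f y = f x - ε * G.laplacian f x := by
  classical
  have h : ∀ y, G.transition ε x y * f y =
      (if y = x then (1 - ε * G.deg x) * f x else 0) + ε / G.m x * (G.b x y * f y) := by
    intro y
    by_cases hy : y = x
    · subst hy; simp [transition, G.b_self]
    · simp [transition, hy]; ring
  rw [Finset.sum_congr rfl fun y _ => h y, Finset.sum_add_distrib, ← Finset.mul_sum,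
    Finset.sum_ite_eq', if_pos (mem_closedNeighborFinset_self hfin x),
    G.laplacian_eq_of_subset fun y hy => mem_closedNeighborFinset_of_adj hfin hy]
  ring

lemma hasSum_transition (hfin : G.LocallyFinite) (ε : ℝ) (x : X) :
    HasSum (G.transition ε x) 1 := by
  have h := sum_transition_mul hfin ε x fun _ => 1
  simp only [mul_one, laplacian, sub_self, mul_zero, tsum_zero, sub_zero] at h
  rw [← h]
  exact hasSum_sum_of_ne_finset_zero fun y hy => transition_eq_zero hfin ε hy

lemma transition_nonneg {ε : ℝ} {x : X} (hε : 0 ≤ ε) (hx : ε * G.deg x ≤ 1) (y : X) :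
    0 ≤ G.transition ε x y := by
  rw [transition]
  split_ifs
  · linarith
  · exact div_nonneg (mul_nonneg hε (G.b_nonneg x y)) (G.m_pos x).le

/-- Affinity in ε turns a mixture of plans for parameters 0 and ε into a plan for `s * ε`. -/
lemma transition_mul (s ε : ℝ) (x y : X) :
    G.transition (s * ε) x y = (1 - s) * G.transition 0 x y + s * G.transition ε x y := by
  simp only [transition]
  split_ifs <;> ring

/-! ### Wasserstein distances of transition distributions -/

/-- The set of costs of transport plans, the infimum of which is the Wasserstein distance. -/
def transportCosts (G : WeightedGraph X) (μ ν : X → ℝ) : Set ℝ :=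
  {c : ℝ | ∃ π : X → X → ℝ, IsTransportPlan μ ν π ∧
    HasSum (fun q : X × X => π q.1 q.2 * (G.dist q.1 q.2 : ℝ)) c}

lemma bddBelow_transportCosts (μ ν : X → ℝ) : BddBelow (G.transportCosts μ ν) := by
  have h : ∀ c ∈ G.transportCosts μ ν, (0 : ℝ) ≤ c := by
    rintro c ⟨π, hπ, hc⟩
    have hnn : ∀ q : X × X, 0 ≤ π q.1 q.2 * (G.dist q.1 q.2 : ℝ) := fun q =>
      mul_nonneg (hπ.nonneg q.1 q.2) (Nat.cast_nonneg _)
    exact HasSum.nonneg hnn hc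
  exact ⟨0, h⟩

lemma transportCosts_transition_nonempty (hfin : G.LocallyFinite) {ε : ℝ} {x y : X} (hε : 0 ≤ ε)
    (hx : ε * G.deg x ≤ 1) (hy : ε * G.deg y ≤ 1) :
    (G.transportCosts (G.transition ε x) (G.transition ε y)).Nonempty :=
  have h := IsTransportPlan.prod (transition_nonneg hε hx) (transition_nonneg hε hy)
    (hasSum_transition hfin ε x) (hasSum_transition hfin ε y)
  ⟨_, _, h, h.hasSum_cost (fun _ => transition_eq_zero hfin ε)
    (fun _ => transition_eq_zero hfin ε) fun x y => (G.dist x y : ℝ)⟩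

/-- Kantorovich testing with a 1-Lipschitz `f`; a lower bound on transport cost is an upper bound on
curvature. -/
lemma le_wasserstein_transition (hfin : G.LocallyFinite) {ε : ℝ} {x y : X} (hε : 0 ≤ ε)
    (hx : ε * G.deg x ≤ 1) (hy : ε * G.deg y ≤ 1) {f : X → ℝ}
    (hf : ∀ x y, f y - f x ≤ G.dist x y) :
    f y - f x + ε * (G.laplacian f x - G.laplacian f y) ≤
      G.wasserstein (G.transition ε x) (G.transition ε y) := by
  refine le_csInf (transportCosts_transition_nonempty hfin hε hx hy) ?_
  rintro c ⟨π, hπ, hc⟩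
  have hS : ∀ z ∉ closedNeighborFinset hfin x, G.transition ε x z = 0 :=
    fun _ => transition_eq_zero hfin ε
  have hT : ∀ z ∉ closedNeighborFinset hfin y, G.transition ε y z = 0 :=
    fun _ => transition_eq_zero hfin ε
  have h := hπ.sub_le_cost hS hT hf
  rw [(hπ.hasSum_cost hS hT fun x y => (G.dist x y : ℝ)).unique hc, sum_transition_mul,
    sum_transition_mul] at h
  linarith

lemma isTransportPlan_transition_zero (hfin : G.LocallyFinite) (x y : X) :
    IsTransportPlan (G.transition 0 x) (G.transition 0 y)
      fun a b => G.transition 0 x a * G.transition 0 y b :=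
  IsTransportPlan.prod (transition_nonneg le_rfl (by simp)) (transition_nonneg le_rfl (by simp))
    (hasSum_transition hfin 0 x) (hasSum_transition hfin 0 y)

lemma hasSum_cost_transition_zero (x y : X) :
    HasSum (fun q : X × X => G.transition 0 x q.1 * G.transition 0 y q.2 * (G.dist q.1 q.2 : ℝ))
      (G.dist x y) := by
  have h := hasSum_single (f := fun q : X × X =>
    G.transition 0 x q.1 * G.transition 0 y q.2 * (G.dist q.1 q.2 : ℝ)) (x, y) fun q hq => by
      have : q.1 ≠ x ∨ q.2 ≠ y := by
        by_contra! hc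
        exact hq (Prod.ext hc.1 hc.2)
      rcases this with h | h <;> simp [transition, h]
  simpa [transition] using h

/-- Convexity of the Wasserstein distance along the lazy transition distributions. -/
lemma wasserstein_transition_mul_le (hfin : G.LocallyFinite) {s ε : ℝ} {x y : X} (hs : 0 < s)
    (hs1 : s ≤ 1) (hε : 0 ≤ ε) (hx : ε * G.deg x ≤ 1) (hy : ε * G.deg y ≤ 1) :
    G.wasserstein (G.transition (s * ε) x) (G.transition (s * ε) y) ≤
      (1 - s) * G.dist x y + s * G.wasserstein (G.transition ε x) (G.transition ε y) := by
  -- Isolating the infimum on the right reduces the claim to one plan at a time.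
  rw [← sub_le_iff_le_add', ← div_le_iff₀' hs]
  refine le_csInf (transportCosts_transition_nonempty hfin hε hx hy) ?_
  rintro c ⟨π, hπ, hc⟩
  rw [div_le_iff₀' hs, sub_le_iff_le_add']
  refine csInf_le (bddBelow_transportCosts _ _) ?_
  refine ⟨fun a b => (1 - s) * (G.transition 0 x a * G.transition 0 y b) + s * π a b, ?_, ?_⟩
  · have h := (isTransportPlan_transition_zero hfin x y).convexComb hπ (sub_nonneg.2 hs1) hs.le
      (sub_add_cancel 1 s)
    simpa only [← transition_mul] using h
  · have h := ((hasSum_cost_transition_zero (G := G) x y).mul_left (1 - s)).add (hc.mul_left s)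
    simpa only [add_mul, mul_assoc] using h

/-! ### The curvature and the Laplacian of the distance -/

/-- The limit that defines the Ollivier curvature of an edge exists, and the curvature is bounded
above by the gradient of the Laplacian of any Lipschitz function that is steepest on that edge. -/
theorem ollivierCurvature_le (hfin : G.LocallyFinite) {x y : X} (hxy : G.graph.Adj x y)
    {f : X → ℝ} (hf : ∀ x y, f y - f x ≤ G.dist x y) (hfxy : f y - f x = 1) :
    G.ollivierCurvature x y ≤ G.laplacian f y - G.laplacian f x := by
  have hd : (G.dist x y : ℝ) = 1 := by
    exact_mod_cast SimpleGraph.dist_eq_one_iff_adj.2 hxy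
  have hdeg : ∀ z, 0 ≤ G.deg z := fun z =>
    mul_nonneg (one_div_nonneg.2 (G.m_pos z).le) (tsum_nonneg fun y => G.b_nonneg z y)
  -- Below `ε₀` both transition functions are probability distributions.
  set ε₀ : ℝ := 1 / (1 + G.deg x + G.deg y) with hε₀
  have hden : 0 < 1 + G.deg x + G.deg y := by linarith [hdeg x, hdeg y]
  have hε₀pos : 0 < ε₀ := one_div_pos.2 hden
  have hmul : ∀ ε, 0 < ε → ε < ε₀ → ε * G.deg x ≤ 1 ∧ ε * G.deg y ≤ 1 := by
    intro ε h0 h1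
    rw [hε₀, lt_div_iff₀ hden] at h1
    have := mul_nonneg h0.le (hdeg x)
    have := mul_nonneg h0.le (hdeg y)
    constructor <;> nlinarith
  set g : ℝ → ℝ := fun ε => G.ollivierCurvatureEps ε x y / ε with hg
  have hbound : ∀ ε ∈ Set.Ioo 0 ε₀, g ε ≤ G.laplacian f y - G.laplacian f x := by
    intro ε hε
    obtain ⟨hx, hy⟩ := hmul ε hε.1 hε.2
    have h := le_wasserstein_transition hfin hε.1.le hx hy hf
    simp only [hg]
    rw [div_le_iff₀ hε.1, ollivierCurvatureEps, hd, div_one]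
    linarith
  -- Convexity of the cost makes the quotient monotone, so its limit at 0+ exists as a supremum and
  -- `limUnder` is not a default value.
  have hanti : AntitoneOn g (Set.Ioo 0 ε₀) := by
    intro δ hδ ε hε hle
    obtain ⟨hx, hy⟩ := hmul ε hε.1 hε.2
    have h := wasserstein_transition_mul_le hfin (div_pos hδ.1 hε.1) ((div_le_one hε.1).2 hle)
      hε.1.le hx hy
    rw [div_mul_cancel₀ _ hε.1.ne', hd] at h
    simp only [hg, ollivierCurvatureEps, hd, div_one]
    rw [div_le_div_iff₀ hε.1 hδ.1]
    have h' := mul_le_mul_of_nonneg_right h hε.1.le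
    have : ((1 - δ / ε) * 1 + δ / ε * G.wasserstein (G.transition ε x) (G.transition ε y)) * ε
        = ε - δ + δ * G.wasserstein (G.transition ε x) (G.transition ε y) := by
      have := hε.1.ne'
      field_simp
    rw [this] at h'
    linarith
  have hlim : Tendsto g (𝓝[>] 0) (𝓝 (sSup (g '' Set.Ioo 0 ε₀))) :=
    hanti.tendsto_nhdsWithin_Ioo_right (Set.nonempty_Ioo.2 hε₀pos)
      ⟨_, by rintro _ ⟨ε, hε, rfl⟩; exact hbound ε hε⟩
  rw [ollivierCurvature, hlim.limUnder_eq]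
  exact le_of_tendsto hlim (by filter_upwards [Ioo_mem_nhdsGT hε₀pos] using hbound)

end WeightedGraph

namespace WeightedGraph

variable {X : Type*} {G : WeightedGraph X}

/-! ### Balls, spheres and the Laplacian of the distance -/

lemma dist_sub_dist_le (hconn : G.Connected) (x₀ x y : X) :
    (G.dist y x₀ : ℝ) - G.dist x x₀ ≤ G.dist x y := by
  have h1 : G.graph.dist y x₀ ≤ G.graph.dist y x + G.graph.dist x x₀ :=
    SimpleGraph.Connected.dist_triangle hconn
  rw [SimpleGraph.dist_comm (u := y) (v := x)] at h1
  rw [sub_le_iff_le_add]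
  exact_mod_cast h1

/-- The witness is the second vertex of a shortest walk from `y` to `x₀`. -/
lemma exists_adj_of_mem_sphere_succ (hconn : G.Connected) {x₀ y : X} {r : ℕ}
    (hy : y ∈ G.sphere x₀ (r + 1)) : ∃ x ∈ G.sphere x₀ r, G.graph.Adj x y := by
  obtain ⟨p, hp⟩ := SimpleGraph.Connected.exists_walk_length_eq_dist hconn y x₀
  have hy' : G.graph.dist y x₀ = r + 1 := hy
  cases p with
  | nil => simp at hy'
  | @cons _ x _ hadj q =>
    refine ⟨x, le_antisymm ?_ ?_, hadj.symm⟩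
    · have := SimpleGraph.dist_le q
      rw [SimpleGraph.Walk.length_cons, hy'] at hp
      change G.graph.dist x x₀ ≤ r
      omega
    · have h1 : G.graph.dist y x₀ ≤ G.graph.dist y x + G.graph.dist x x₀ :=
        SimpleGraph.Connected.dist_triangle hconn
      rw [SimpleGraph.dist_eq_one_iff_adj.2 hadj] at h1
      change r ≤ G.graph.dist x x₀
      omega

lemma finite_sphere (hfin : G.LocallyFinite) (hconn : G.Connected) (x₀ : X) (r : ℕ) :
    (G.sphere x₀ r).Finite := by
  induction r with
  | zero =>
    refine (Set.finite_singleton x₀).subset fun x hx => ?_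
    exact (SimpleGraph.Connected.dist_eq_zero_iff hconn).1 hx
  | succ r ih =>
    refine (ih.biUnion fun x _ => hfin x).subset fun y hy => ?_
    obtain ⟨x, hx, hxy⟩ := exists_adj_of_mem_sphere_succ hconn hy
    exact Set.mem_biUnion hx hxy

lemma finite_setOf_dist_lt (hfin : G.LocallyFinite) (hconn : G.Connected) (x₀ : X) (n : ℕ) :
    {x | G.dist x x₀ < n}.Finite :=
  ((Set.finite_lt_nat n).biUnion fun r _ => finite_sphere hfin hconn x₀ r).subset
    fun x hx => Set.mem_biUnion (x := G.dist x x₀) hx rfl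

/-- Spheres are finite and the set of inner neighbors is nonempty, so the supremum is attained and
the infimum is a genuine lower bound. -/
lemma exists_sphereCurvature_le (hfin : G.LocallyFinite) (hconn : G.Connected) {x₀ y : X} {r : ℕ}
    (hy : y ∈ G.sphere x₀ (r + 1)) :
    ∃ x ∈ G.sphere x₀ r, G.graph.Adj x y ∧
      G.sphereCurvature x₀ (r + 1) ≤ G.ollivierCurvature x y := by
  have : Finite (G.sphere x₀ (r + 1)) := finite_sphere hfin hconn x₀ (r + 1)
  have : Finite {x : X // x ∈ G.sphere x₀ r ∧ G.graph.Adj x y} :=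
    ((finite_sphere hfin hconn x₀ r).subset fun x hx => hx.1 :
      {x : X | x ∈ G.sphere x₀ r ∧ G.graph.Adj x y}.Finite)
  obtain ⟨x, hx⟩ := exists_adj_of_mem_sphere_succ hconn hy
  have : Nonempty {x : X // x ∈ G.sphere x₀ r ∧ G.graph.Adj x y} := ⟨⟨x, hx⟩⟩
  obtain ⟨z, hz⟩ := exists_eq_ciSup_of_finite
    (f := fun x : {x : X // x ∈ G.sphere x₀ r ∧ G.graph.Adj x y} => G.ollivierCurvature x y)
  refine ⟨z, z.2.1, z.2.2, ?_⟩
  rw [hz]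
  exact ciInf_le (f := fun y : G.sphere x₀ (r + 1) =>
    ⨆ x : {x : X // x ∈ G.sphere x₀ r ∧ G.graph.Adj x y}, G.ollivierCurvature x y)
    (Set.finite_range _).bddBelow ⟨y, hy⟩

/-- Laplacian comparison: the sphere curvatures control the Laplacian of the distance. -/
theorem laplacian_dist_ge (hfin : G.LocallyFinite) (hconn : G.Connected) (x₀ : X) (r : ℕ) :
    ∀ y ∈ G.sphere x₀ r, G.laplacian (fun z => (G.dist z x₀ : ℝ)) x₀ +
      ∑ j ∈ Finset.range r, G.sphereCurvature x₀ (j + 1) ≤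
        G.laplacian (fun z => (G.dist z x₀ : ℝ)) y := by
  induction r with
  | zero =>
    intro y hy
    rw [(SimpleGraph.Connected.dist_eq_zero_iff hconn).1 hy]
    simp
  | succ r ih =>
    intro y hy
    obtain ⟨x, hx, hxy, hle⟩ := exists_sphereCurvature_le hfin hconn hy
    have h := ollivierCurvature_le hfin hxy (f := fun z => (G.dist z x₀ : ℝ))
      (dist_sub_dist_le hconn x₀) (by
        rw [show G.dist y x₀ = r + 1 from hy, show G.dist x x₀ = r from hx]
        push_cast
        ring)
    rw [Finset.sum_range_succ]
    linarith [ih x hx]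

/-! ### Iterated logarithms -/

/-- The shift 3 exceeds e, which keeps log log(·+3) nonnegative on distances. -/
lemma one_le_log_add_three {a : ℝ} (ha : 0 ≤ a) : 1 ≤ Real.log (a + 3) := by
  rw [Real.le_log_iff_exp_le (by linarith)]
  linarith [Real.exp_one_lt_d9]

lemma log_le_log_add_div {a b : ℝ} (ha : 0 < a) (hb : 0 < b) :
    Real.log b ≤ Real.log a + (b - a) / a := by
  have h := Real.log_le_sub_one_of_pos (div_pos hb ha)
  rw [Real.log_div hb.ne' ha.ne'] at h
  rw [sub_div, div_self ha.ne']
  linarith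

/-- The graph of log log(·+3) lies below its tangent at `a`: apply the tangent bound for log twice.
-/
lemma log_log_le {a b : ℝ} (ha : 0 ≤ a) (hb : 0 ≤ b) :
    Real.log (Real.log (b + 3)) ≤
      Real.log (Real.log (a + 3)) + (b - a) / ((a + 3) * Real.log (a + 3)) := by
  have hu := one_le_log_add_three ha
  have hv := one_le_log_add_three hb
  have h1 := log_le_log_add_div (zero_lt_one.trans_le hu) (zero_lt_one.trans_le hv)
  have h2 := log_le_log_add_div (a := a + 3) (b := b + 3) (by linarith) (by linarith)
  have h3 : (Real.log (b + 3) - Real.log (a + 3)) / Real.log (a + 3) ≤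
      ((b - a) / (a + 3)) / Real.log (a + 3) := by
    refine div_le_div_of_nonneg_right ?_ (by linarith)
    rw [show b + 3 - (a + 3) = b - a by ring] at h2
    linarith
  rw [div_div] at h3
  linarith

/-- A chain rule for the concave function `log log (· + 3)`. -/
lemma laplacian_log_log_ge (hfin : G.LocallyFinite) {f : X → ℝ} (hf : ∀ x, 0 ≤ f x) (x : X) :
    G.laplacian f x / ((f x + 3) * Real.log (f x + 3)) ≤
      G.laplacian (fun z => Real.log (Real.log (f z + 3))) x := by
  have hsum : ∀ g : X → ℝ, Summable fun y => G.b x y * (g x - g y) := fun g =>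
    summable_of_ne_finset_zero (s := (hfin x).toFinset) fun y hy => by
      rw [G.b_eq_zero_of_not_adj fun h => hy ((hfin x).mem_toFinset.2 h), zero_mul]
  have hle : ∀ y, G.b x y * (f x - f y) / ((f x + 3) * Real.log (f x + 3)) ≤
      G.b x y * (Real.log (Real.log (f x + 3)) - Real.log (Real.log (f y + 3))) := by
    intro y
    rw [mul_div_assoc]
    refine mul_le_mul_of_nonneg_left ?_ (G.b_nonneg x y)
    have h := log_log_le (hf x) (hf y)
    rw [← neg_sub (f x) (f y), neg_div] at h
    linarith
  have h := Summable.tsum_le_tsum hle ((hsum f).div_const _)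
    (hsum fun z => Real.log (Real.log (f z + 3)))
  rw [tsum_div_const] at h
  rw [laplacian, laplacian, mul_div_assoc]
  exact mul_le_mul_of_nonneg_left h (one_div_nonneg.2 (G.m_pos x).le)

lemma exists_bound_of_eventually_ge_log {k : ℕ → ℝ} {C : ℝ} (hC : 0 ≤ C)
    (h : ∀ᶠ r : ℕ in atTop, k r ≥ -C * Real.log r) (c : ℝ) :
    ∃ A, 0 ≤ A ∧ ∀ r : ℕ, -(A * (((r : ℝ) + 3) * Real.log (r + 3))) ≤
      c + ∑ j ∈ Finset.range r, k (j + 1) := by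
  obtain ⟨R, hR⟩ := eventually_atTop.1 h
  -- The sum absorbs the finitely many radii below `R`, where no bound is assumed.
  set B : ℝ := C + ∑ j ∈ Finset.range R, |k j| with hB
  have hS : 0 ≤ ∑ j ∈ Finset.range R, |k j| := Finset.sum_nonneg fun j _ => abs_nonneg _
  have hB0 : 0 ≤ B := add_nonneg hC hS
  have hk : ∀ j r : ℕ, j ≤ r → -(B * Real.log (r + 3)) ≤ k j := by
    intro j r hjr
    have hl := one_le_log_add_three (Nat.cast_nonneg (α := ℝ) r)
    rcases lt_or_ge j R with hj | hj
    · have h1 : |k j| ≤ ∑ j ∈ Finset.range R, |k j| :=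
        Finset.single_le_sum (f := fun j => |k j|) (fun j _ => abs_nonneg _) (Finset.mem_range.2 hj)
      have h2 : B * 1 ≤ B * Real.log (r + 3) := mul_le_mul_of_nonneg_left hl hB0
      linarith [neg_abs_le (k j)]
    · have h1 : Real.log j ≤ Real.log (r + 3) := by
        -- `R` may be 0; then `j = 0` occurs and uses the convention log 0 = 0.
        rcases Nat.eq_zero_or_pos j with rfl | hj0
        · simp only [Nat.cast_zero, Real.log_zero]; linarith
        · refine Real.log_le_log (by exact_mod_cast hj0) ?_
          have : (j : ℝ) ≤ r := by exact_mod_cast hjr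
          linarith
      have h2 := mul_le_mul_of_nonneg_left h1 hC
      have h3 : C * Real.log (r + 3) ≤ B * Real.log (r + 3) :=
        mul_le_mul_of_nonneg_right (by linarith) (by linarith)
      linarith [hR j hj]
  refine ⟨B + |c|, by positivity, fun r => ?_⟩
  have hl := one_le_log_add_three (Nat.cast_nonneg (α := ℝ) r)
  have hsum : (r : ℝ) * -(B * Real.log (r + 3)) ≤ ∑ j ∈ Finset.range r, k (j + 1) := by
    have := Finset.card_nsmul_le_sum (Finset.range r) (fun j => k (j + 1)) _
      fun j hj => hk (j + 1) r (Finset.mem_range.1 hj)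
    simpa using this
  have h1 : |c| * 1 ≤ |c| * (((r : ℝ) + 3) * Real.log (r + 3)) := by
    refine mul_le_mul_of_nonneg_left (one_le_mul_of_one_le_of_one_le ?_ hl) (abs_nonneg c)
    linarith [Nat.cast_nonneg (α := ℝ) r]
  have h2 : 0 ≤ B * Real.log (r + 3) := mul_nonneg hB0 (by linarith)
  linarith [neg_abs_le c]

end WeightedGraph

theorem theoremt {X : Type*} [Countable X] [Infinite X] (G : WeightedGraph X)
    (hfin : G.LocallyFinite) (hconn : G.Connected) (x₀ : X) (C : ℝ) (hC : 0 < C)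
    (hκ : ∀ᶠ r : ℕ in Filter.atTop, G.sphereCurvature x₀ r ≥ -C * Real.log (r : ℝ)) :
    G.StochasticallyComplete := by
  set f : X → ℝ := fun z => (G.dist z x₀ : ℝ) with hf
  have hf0 : ∀ x, 0 ≤ f x := fun x => Nat.cast_nonneg _
  obtain ⟨A, hA0, hA⟩ :=
    WeightedGraph.exists_bound_of_eventually_ge_log hC.le hκ (G.laplacian f x₀)
  have hlog : ∀ x, 1 ≤ Real.log (f x + 3) := fun x => WeightedGraph.one_le_log_add_three (hf0 x)
  refine G.stochasticallyComplete_of_laplacian_ge hfin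
    (w := fun z => Real.log (Real.log (f z + 3))) (fun x => Real.log_nonneg (hlog x)) hA0
    (fun x => le_trans ?_ (WeightedGraph.laplacian_log_log_ge hfin hf0 x)) fun M => ?_
  · have hpos : 0 < (f x + 3) * Real.log (f x + 3) :=
      mul_pos (by linarith [hf0 x]) (by linarith [hlog x])
    rw [le_div_iff₀ hpos, neg_mul]
    exact (hA _).trans (WeightedGraph.laplacian_dist_ge hfin hconn x₀ _ x rfl)
  -- Inverting both logarithms places the sublevel set of `w` in a ball.
  · obtain ⟨n, hn⟩ := exists_nat_gt (Real.exp (Real.exp M))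
    refine (WeightedGraph.finite_setOf_dist_lt hfin hconn x₀ n).subset fun x hx => ?_
    have h1 : Real.log (f x + 3) < Real.exp M :=
      (Real.log_lt_iff_lt_exp (by linarith [hlog x])).1 hx
    have h2 : f x + 3 < Real.exp (Real.exp M) :=
      (Real.log_lt_iff_lt_exp (by linarith [hf0 x])).1 h1
    have h3 : f x < n := by linarith
    exact Nat.cast_lt.1 h3
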